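/- Let $H$ be a complex Hilbert space, $\mathcal M$ a von Neumann algebra on $H$, and $a$ a positive selfadjoint (possibly unbounded) operator in $H$ affiliated with $\mathcal M$. Let $a=\int_{[0,\infty)}\lambda\,dP_\lambda$ be its spectral decomposition and put $a_0=\int_{[0,1]}\lambda\,dP_\lambda$, $a_\infty=\int_{(1,\infty)}\lambda\,dP_\lambda$; their real powers are taken in the functional calculus on $H$ (with $0^0=1$, so that $b^0=\mathbf 1$). For positive selfadjoint operators $b,c$ and $x\in\mathcal M$ let $\widehat{bxc}$ be the sesquilinear form $(f,g)\mapsto\langle xcf,bg\rangle$ on $D(c)\times D(b)$, and let $\mathcal S_{b,c}(\mathcal M)=\{\widehat{bxc} : x\in\mathcal M\}$, with the norm $\|s\|_{b,c}=\inf\{\|x\| : x\in\mathcal M,\ \widehat{bxc}=s\}$ (which satisfies $\|\widehat{bxc}\|_{b,c}=\|x\|$ if $b$ and $c$ have dense ranges). For $\alpha\ge 0$ and $\gamma>0$ put $\mathcal S_{0,\infty}^{\alpha,\gamma}=\mathcal S_{a_0^\alpha,a_\infty^\gamma}(\mathcal M)$. Forms belonging to spaces $\mathcal S_{0,\infty}^{\alpha,\gamma}$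 with different exponents are identified when they have the same restriction to $\mathcal D\times H$, where $\mathcal D=\bigcap_{s\ge 0}D(a_\infty^s)$ is a common core of all $a_\infty^s$. Let $$\mathfrak S_0^\alpha=\bigcup_{\gamma>0}\mathcal S_{0,\infty}^{\alpha,\gamma},$$ and let $\tau_0^\alpha$ be the strongest topology on $\mathfrak S_0^\alpha$ for which all the mappings $$\varphi_\gamma^\alpha:\ x\in(\mathcal S_{0,\infty}^{\alpha,\gamma},\|\cdot\|_{a_0^\alpha,a_\infty^\gamma})\ \mapsto\ x\in\mathfrak S_0^\alpha,\qquad \gamma>0,$$ are continuous. Then for all real $0\le\alpha<\beta$ one has $\mathfrak S_0^\beta\subset\mathfrak S_0^\alpha$, and the topology induced by $\tau_0^\alpha$ on $\mathfrak S_0^\beta$ is coarser than (or equal to) $\tau_0^\beta$: $$\tau_0^\alpha|_\beta:=\{X\cap\mathfrak S_0^\beta : X\in\tau_0^\alpha\}\subset\tau_0^\beta.$$ Equivalently, the inclusion $(\mathfrak S_0^\beta,\tau_0^\beta)\to(\mathfrak S_0^\alpha,\tau_0^\alpha)$ is continuous. -/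

import Mathlib

open Filter Topology

noncomputable section

namespace PowerLimits

variable {H : Type*} [NormedAddCommGroup H] [InnerProductSpace ℂ H] [CompleteSpace H]

/-! ### Positive self-adjoint operators affiliated with a von Neumann algebra -/

/-- `b` is a positive self-adjoint (in general unbounded) operator in `H`. In Mathlib
self-adjointness `b† = b` of a partially defined operator forces its domain to be dense. -/
structure IsPositiveSelfAdjoint (b : H →ₗ.[ℂ] H) : Prop where
  isSelfAdjoint : IsSelfAdjoint b
  nonneg : ∀ f : b.domain, 0 ≤ (inner ℂ (b f) (f : H)).re

/-- `b η M`: every operator `y` of the commutant of `M` satisfies `y b ⊆ b y`. -/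
def IsAffiliated (M : VonNeumannAlgebra H) (b : H →ₗ.[ℂ] H) : Prop :=
  ∀ y ∈ M.commutant, ∀ f : b.domain,
    ∃ h : y (f : H) ∈ b.domain, b ⟨y (f : H), h⟩ = y (b f)

/-! ### Bounded functions of a positive self-adjoint operator -/

/-- `R` is the bounded inverse `(μ + b)⁻¹ : H → D(b)` of the operator `μ + b : D(b) → H`. -/
def IsShiftInverse (b : H →ₗ.[ℂ] H) (μ : ℝ) (R : H →L[ℂ] H) : Prop :=
  (∀ f : H, ∃ h : R f ∈ b.domain, (μ : ℂ) • R f + b ⟨R f, h⟩ = f) ∧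
    ∀ f : b.domain, R ((μ : ℂ) • (f : H) + b f) = f

/-- The bounded inverse of `μ + b` exists for positive self-adjoint `b` and `μ > 0`. -/
theorem IsPositiveSelfAdjoint.exists_isShiftInverse (b : H →ₗ.[ℂ] H) (hb : IsPositiveSelfAdjoint b) (μ : ℝ) (hμ : 0 < μ) :
    ∃ R, IsShiftInverse b μ R := by
  have hd := hb.isSelfAdjoint.dense_domain
  have hcl := hb.isSelfAdjoint.isClosed
  let T : b.domain →ₗ[ℂ] H := (μ : ℂ) • b.domain.subtype + b.toFun
  have hT : ∀ f : b.domain, T f = (μ:ℂ) • (f:H) + b f := fun f => rfl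
  have low : ∀ f : b.domain, μ * ‖(f:H)‖ ≤ ‖T f‖ := by
    intro f
    rcases eq_or_ne (f:H) 0 with h0 | h0
    · rw [h0]; simp
    have h1 : μ * ‖(f:H)‖^2 ≤ (inner ℂ (T f) (f:H)).re := by
      rw [hT, inner_add_left, inner_smul_left, Complex.add_re]
      have := hb.nonneg f
      have h2 : (inner ℂ (f:H) (f:H)) = ((‖(f:H)‖^2 : ℝ):ℂ) := by
        rw [inner_self_eq_norm_sq_to_K]; norm_cast
      rw [h2]; simp only [Complex.conj_ofReal, ← Complex.ofReal_mul, Complex.ofReal_re]; linarith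
    have h3 : (inner ℂ (T f) (f:H)).re ≤ ‖T f‖ * ‖(f:H)‖ :=
      (Complex.re_le_norm _).trans (norm_inner_le_norm _ _)
    have : 0 < ‖(f:H)‖ := norm_pos_iff.2 h0
    nlinarith
  have hinj : Function.Injective T := by
    rw [injective_iff_map_eq_zero]
    intro f hf
    have := low f
    rw [hf, norm_zero] at this
    have : ‖(f:H)‖ ≤ 0 := by nlinarith
    exact Subtype.ext (norm_le_zero_iff.1 this)
  have hclosed : IsClosed (LinearMap.range T : Set H) := by
    refine IsSeqClosed.isClosed ?_
    intro x y hx hxy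
    choose u hu using hx
    have hc : CauchySeq (fun n => ((u n : b.domain) : H)) := by
      have hx' := hxy.cauchySeq
      rw [Metric.cauchySeq_iff] at hx' ⊢
      intro ε hε
      obtain ⟨N, hN⟩ := hx' (μ * ε) (by positivity)
      refine ⟨N, fun m hm n hn => ?_⟩
      have h1 := hN m hm n hn
      rw [dist_eq_norm, ← hu, ← hu, ← map_sub] at h1
      have h2 := low (u m - u n)
      rw [dist_eq_norm]
      have h3 : ‖((u m - u n : b.domain) : H)‖ = ‖(u m : H) - u n‖ := rfl
      rw [h3] at h2
      exact lt_of_mul_lt_mul_left (h2.trans_lt h1) hμ.le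
    obtain ⟨v, hv⟩ := cauchySeq_tendsto_of_complete hc
    have hbv : Tendsto (fun n => b (u n)) atTop (𝓝 (y - (μ:ℂ) • v)) := by
      have : (fun n => b (u n)) = fun n => x n - (μ:ℂ) • (u n : H) := by
        ext n; rw [← hu, hT]; simp
      rw [this]; exact hxy.sub (hv.const_smul _)
    have hg : (v, y - (μ:ℂ) • v) ∈ b.graph := by
      have := IsClosed.mem_of_tendsto hcl (hv.prodMk_nhds hbv) (Eventually.of_forall fun n => b.mem_graph (u n))
      exact this
    rw [LinearPMap.mem_graph_iff] at hg
    obtain ⟨w, hw1, hw2⟩ := hg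
    refine ⟨w, ?_⟩
    rw [hT]
    simp only at hw1 hw2
    rw [hw2, hw1]; simp
  have hsurj : LinearMap.range T = ⊤ := by
    have : CompleteSpace (LinearMap.range T) := hclosed.completeSpace_coe
    rw [← Submodule.orthogonal_eq_bot_iff, eq_bot_iff]
    intro g hg
    have h1 : ∀ f : b.domain, inner ℂ (-(μ:ℂ) • g) (f:H) = inner ℂ g (b f) := by
      intro f
      have := (Submodule.mem_orthogonal' _ _).1 hg (T f) ⟨f, rfl⟩
      rw [hT, inner_add_right, inner_smul_right] at this
      rw [inner_smul_left]
      simp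
      linear_combination -this
    have hsa : b.adjoint = b := hb.isSelfAdjoint
    have h2 := LinearPMap.mem_adjoint_domain_of_exists (T := b) g ⟨_, h1⟩
    have h3 := LinearPMap.adjoint_apply_eq hd (⟨g, h2⟩ : b.adjoint.domain) h1
    have h4 : ∃ h : g ∈ b.domain, b ⟨g, h⟩ = -(μ:ℂ) • g := by
      revert h2 h3; rw [hsa]; intro h2 h3; exact ⟨h2, h3⟩
    obtain ⟨h5, h6⟩ := h4
    have h7 : T ⟨g, h5⟩ = 0 := by rw [hT, h6]; simp
    have := hinj (h7.trans (map_zero T).symm)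
    simpa using congrArg Subtype.val this
  let e := LinearEquiv.ofBijective T ⟨hinj, LinearMap.range_eq_top.1 hsurj⟩
  have he : ∀ f, T (e.symm f) = f := fun f => e.apply_symm_apply f
  let R : H →L[ℂ] H := (b.domain.subtype ∘ₗ e.symm.toLinearMap).mkContinuous μ⁻¹ (by
    intro f
    have := low (e.symm f)
    rw [he] at this
    rw [← div_eq_inv_mul, le_div_iff₀ hμ, mul_comm]
    exact this)
  refine ⟨R, fun f => ⟨(e.symm f).2, he f⟩, fun f => ?_⟩
  change ((e.symm (T f)) : H) = f
  rw [show e.symm (T f) = f from e.symm_apply_apply f]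

open Classical in
/-- The bounded operator `(μ + b)⁻¹`. It exists for every positive self-adjoint `b` and every
`μ > 0`; where there is no bounded inverse the value is `0`. -/
def shiftInverse (b : H →ₗ.[ℂ] H) (μ : ℝ) : H →L[ℂ] H :=
  if h : ∃ R, IsShiftInverse b μ R then h.choose else 0

/-- The bounded operator `b_μ = μ b (μ + b)⁻¹ = μ (1 - μ (μ + b)⁻¹)`. -/
def approx (b : H →ₗ.[ℂ] H) (μ : ℝ) : H →L[ℂ] H :=
  (μ : ℂ) • (1 - (μ : ℂ) • shiftInverse b μ)

/-- The value at `μ ≥ 0` of the spectral resolution of a positive self-adjoint `b`, that is the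
spectral projection of `b` for `[0, μ]`. A number `t ≥ 0` satisfies `t ≤ μ` if and only if the
positive part of `(1 + μ)⁻¹ - (1 + t)⁻¹` vanishes, so this is the orthogonal projection onto the
kernel of the positive part of the bounded self-adjoint operator `(1 + μ)⁻¹ - (1 + b)⁻¹`. -/
def spectralProj (b : H →ₗ.[ℂ] H) (μ : ℝ) : H →L[ℂ] H :=
  (LinearMap.ker
    (((((1 + μ : ℝ)⁻¹ : ℝ) : ℂ) • (1 : H →L[ℂ] H) - shiftInverse b 1)⁺).toLinearMap).starProjection

/-! ### Products with a projection, and powers -/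

/-- The operator product `b p`, with domain `{f | p f ∈ D(b)}`. -/
def mulRight (b : H →ₗ.[ℂ] H) (p : H →L[ℂ] H) : H →ₗ.[ℂ] H where
  domain := b.domain.comap p.toLinearMap
  toFun := b.toFun ∘ₗ p.toLinearMap.restrict (fun _ h => h)

/-- `a_0 = ∫_{[0,1]} λ dP_λ = a p_0` with `p_0` the spectral projection of `a` for `[0, 1]`. -/
def lowerPart (a : H →ₗ.[ℂ] H) : H →ₗ.[ℂ] H := mulRight a (spectralProj a 1)

/-- `a_∞ = ∫_{(1,∞)} λ dP_λ = a p_∞` with `p_∞ = 1 - p_0`. -/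
def upperPart (a : H →ₗ.[ℂ] H) : H →ₗ.[ℂ] H := mulRight a (1 - spectralProj a 1)

/-- The power `b ^ s`, `s ≥ 0`, of a positive self-adjoint `b`:
`b ^ s f = lim_{μ → ∞} (b_μ) ^ s f`, defined for exactly those `f` for which the limit exists in
`H`. Here `(b_μ) ^ s` is the power of the bounded positive operator `b_μ` in the continuous
functional calculus; since `(μ t / (μ + t)) ^ s` increases to `t ^ s`, this is the operator
`∫ t ^ s dP_t` with its domain `{f | ∫ t ^ (2 s) d⟨P_t f, f⟩ < ∞}`. -/
def power (b : H →ₗ.[ℂ] H) (s : ℝ) : H →ₗ.[ℂ] H where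
  domain :=
    { carrier := {f | ∃ y, Tendsto (fun μ : ℝ => (approx b μ ^ s : H →L[ℂ] H) f) atTop (𝓝 y)}
      zero_mem' := ⟨0, by simp⟩
      add_mem' := by
        rintro f g ⟨y, hy⟩ ⟨z, hz⟩
        exact ⟨y + z, by simpa using hy.add hz⟩
      smul_mem' := by
        rintro c f ⟨y, hy⟩
        exact ⟨c • y, by simpa using hy.const_smul c⟩ }
  toFun :=
    { toFun := fun f => f.2.choose
      map_add' := fun f g => tendsto_nhds_unique (f + g).2.choose_spec (by
        simpa using f.2.choose_spec.add g.2.choose_spec)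
      map_smul' := fun c f => tendsto_nhds_unique (c • f).2.choose_spec (by
        simpa using f.2.choose_spec.const_smul c) }

/-! ### The normed spaces `S_{a,b}(M)` of sesquilinear forms -/

/-- Sesquilinear forms on `D(b) × D(a)`, linear in the first variable. -/
abbrev Form (a b : H →ₗ.[ℂ] H) : Type _ := b.domain →ₗ[ℂ] a.domain →ₗ⋆[ℂ] ℂ

/-- `x ↦ (a x b)^`, the sesquilinear form `(f, g) ↦ ⟨x b f, a g⟩` on `D(b) × D(a)`. The scalar
product of the source is linear in its first variable, that of Mathlib in its second one. -/
def formOf (a b : H →ₗ.[ℂ] H) : (H →L[ℂ] H) →ₗ[ℂ] Form a b where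
  toFun x := LinearMap.mk₂'ₛₗ (RingHom.id ℂ) (starRingEnd ℂ)
    (fun f g => inner ℂ (a g) (x (b f)))
    (by intros; simp [LinearPMap.map_add])
    (by intros; simp [LinearPMap.map_smul])
    (by intros; simp [LinearPMap.map_add])
    (by intros; simp [LinearPMap.map_smul, mul_comm])
  map_add' x y := by ext; simp
  map_smul' c x := by ext; simp

/-- The linear space `S_{a,b}(M) = {(a x b)^ | x ∈ M}`. -/
def formSpace (M : VonNeumannAlgebra H) (a b : H →ₗ.[ℂ] H) : Submodule ℂ (Form a b) :=
  (Subalgebra.toSubmodule M.toStarSubalgebra.toSubalgebra).map (formOf a b)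

/-- The norms of the operators of `M` that represent a given form. -/
def reprNorms (M : VonNeumannAlgebra H) (a b : H →ₗ.[ℂ] H) (s : formSpace M a b) : Set ℝ :=
  {r | ∃ x ∈ M, formOf a b x = s ∧ ‖x‖ = r}

theorem reprNorms_nonempty (M : VonNeumannAlgebra H) (a b : H →ₗ.[ℂ] H) (s : formSpace M a b) :
    (reprNorms M a b s).Nonempty := by
  obtain ⟨x, hx, h⟩ := s.2
  exact ⟨‖x‖, x, hx, h, rfl⟩

theorem reprNorms_bddBelow (M : VonNeumannAlgebra H) (a b : H →ₗ.[ℂ] H) (s : formSpace M a b) :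
    BddBelow (reprNorms M a b s) :=
  ⟨0, by rintro r ⟨x, -, -, rfl⟩; exact norm_nonneg x⟩

/-- The norm of `S_{a,b}(M)`: `‖s‖` is the infimum of `‖x‖` over all `x ∈ M` with `s = (a x b)^`.
If `a` and `b` have dense ranges, then `x` is determined by the form and the norm is `‖x‖`
(see `formNorm_formOf`); for `a`, `b` with ranges dense in `p H`, `q H`, where `p, q ∈ M` are
projections, it is `‖p x q‖`. -/
def formNorm (M : VonNeumannAlgebra H) (a b : H →ₗ.[ℂ] H) : AddGroupNorm (formSpace M a b) where
  toFun s := sInf (reprNorms M a b s)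
  map_zero' := by
    refine le_antisymm (csInf_le (reprNorms_bddBelow M a b 0) ?_)
      (le_csInf (reprNorms_nonempty M a b 0) ?_)
    · exact ⟨0, zero_mem M, by simp, by simp⟩
    · rintro r ⟨x, -, -, rfl⟩; exact norm_nonneg x
  add_le' s t := by
    rw [← csInf_add (reprNorms_nonempty M a b s) (reprNorms_bddBelow M a b s)
      (reprNorms_nonempty M a b t) (reprNorms_bddBelow M a b t)]
    refine le_csInf ((reprNorms_nonempty M a b s).add (reprNorms_nonempty M a b t)) ?_
    rintro _ ⟨_, ⟨x, hx, hxs, rfl⟩, _, ⟨y, hy, hyt, rfl⟩, rfl⟩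
    exact (csInf_le (reprNorms_bddBelow M a b (s + t))
      ⟨x + y, add_mem hx hy, by simp [hxs, hyt], rfl⟩).trans (norm_add_le x y)
  neg' s := by
    congr 1
    ext r
    constructor
    · rintro ⟨x, hx, h, rfl⟩
      exact ⟨-x, neg_mem hx, by simp [h], norm_neg x⟩
    · rintro ⟨x, hx, h, rfl⟩
      exact ⟨-x, neg_mem hx, by simp [h], norm_neg x⟩
  eq_zero_of_map_eq_zero' s hs := by
    have key : ∀ f g, (s : Form a b) f g = 0 := by
      intro f g
      rw [← norm_le_zero_iff]
      refine le_of_forall_pos_le_add fun ε hε => ?_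
      have hC : 0 < ‖a g‖ * ‖b f‖ + 1 := by positivity
      obtain ⟨_, ⟨x, -, hxs, rfl⟩, hx⟩ := exists_lt_of_csInf_lt (reprNorms_nonempty M a b s)
        (show sInf (reprNorms M a b s) < ε / (‖a g‖ * ‖b f‖ + 1) by
          have hs' : sInf (reprNorms M a b s) = 0 := hs
          rw [hs']; positivity)
      rw [lt_div_iff₀ hC] at hx
      have h1 : ‖(s : Form a b) f g‖ ≤ ‖a g‖ * (‖x‖ * ‖b f‖) := by
        rw [← hxs]
        exact (norm_inner_le_norm (𝕜 := ℂ) (a g) (x (b f))).trans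
          (mul_le_mul_of_nonneg_left (x.le_opNorm _) (norm_nonneg _))
      nlinarith [norm_nonneg x]
    exact Subtype.ext (LinearMap.ext fun f => LinearMap.ext fun g => key f g)

theorem formNorm_formOf (M : VonNeumannAlgebra H) (a b : H →ₗ.[ℂ] H)
    (ha : DenseRange a) (hb : DenseRange b) (x : H →L[ℂ] H) (hx : x ∈ M) :
    formNorm M a b ⟨formOf a b x, x, hx, rfl⟩ = ‖x‖ := by
  have huniq : ∀ y, formOf a b y = formOf a b x → y = x := by
    intro y hy
    refine ContinuousLinearMap.ext fun v => ?_
    refine congrFun (hb.equalizer y.continuous x.continuous (funext fun f => ?_)) v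
    refine ext_inner_left ℂ fun w => ?_
    have hw : (fun w : H => inner ℂ w (y (b f))) = fun w => inner ℂ w (x (b f)) := by
      refine DenseRange.equalizer ha (by fun_prop) (by fun_prop) (funext fun g => ?_)
      exact congrArg (fun s : Form a b => s f g) hy
    exact congrFun hw w
  change sInf _ = _
  have : reprNorms M a b ⟨formOf a b x, x, hx, rfl⟩ = {‖x‖} := by
    ext r
    constructor
    · rintro ⟨y, -, h, rfl⟩
      rw [huniq y h]; rfl
    · rintro rfl
      exact ⟨x, hx, rfl, rfl⟩
  rw [this, csInf_singleton]

/-- The topology of the norm of `S_{a,b}(M)`. -/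
abbrev formTopology (M : VonNeumannAlgebra H) (a b : H →ₗ.[ℂ] H) :
    TopologicalSpace (formSpace M a b) :=
  (formNorm M a b).toNormedAddCommGroup.toPseudoMetricSpace.toUniformSpace.toTopologicalSpace

/-! ### The limit spaces and their topologies -/

/-- `D^∞(b) = ⋂_{s ≥ 0} D(b ^ s)`, which is a core for every power `b ^ s` of a positive
self-adjoint operator `b` (and is `H` if `b` is bounded). -/
def smoothDomain (b : H →ₗ.[ℂ] H) : Submodule ℂ H :=
  ⨅ (s : ℝ) (_ : 0 ≤ s), (power b s).domain

theorem smoothDomain_le (b : H →ₗ.[ℂ] H) {s : ℝ} (hs : 0 ≤ s) :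
    smoothDomain b ≤ (power b s).domain :=
  iInf₂_le s hs

/-- Sesquilinear forms on `D^∞(a_∞) × D^∞(a_0)`. -/
abbrev CommonForm (a : H →ₗ.[ℂ] H) : Type _ :=
  smoothDomain (upperPart a) →ₗ[ℂ] smoothDomain (lowerPart a) →ₗ⋆[ℂ] ℂ

/-- The normed space `S_{0,∞}^{α,γ} = S_{a_0^α, a_∞^γ}(M)`, a space of forms on
`D(a_∞^γ) × D(a_0^α)`. -/
abbrev powerFormSpace (M : VonNeumannAlgebra H) (a : H →ₗ.[ℂ] H) (α γ : ℝ) :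
    Submodule ℂ (Form (power (lowerPart a) α) (power (upperPart a) γ)) :=
  formSpace M (power (lowerPart a) α) (power (upperPart a) γ)

/-- Restriction of a form on `D(a_∞^γ) × D(a_0^α)` to `D^∞(a_∞) × D^∞(a_0)`. As these are cores,
no information is lost. The forms of the spaces `S_{0,∞}^{α,γ}` with different exponents have
different domains and are identified if they have the same restriction. -/
def restrictForm (a : H →ₗ.[ℂ] H) {α γ : ℝ} (hα : 0 ≤ α) (hγ : 0 ≤ γ)
    (s : Form (power (lowerPart a) α) (power (upperPart a) γ)) : CommonForm a :=
  LinearMap.mk₂'ₛₗ (RingHom.id ℂ) (starRingEnd ℂ)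
    (fun f g => s (Submodule.inclusion (smoothDomain_le _ hγ) f)
      (Submodule.inclusion (smoothDomain_le _ hα) g))
    (by intros; simp) (by intros; simp) (by intros; simp) (by intros; simp)

/-- `𝔖_0^α = ⋃_{γ > 0} S_{0,∞}^{α,γ}`. -/
def limitSpace (M : VonNeumannAlgebra H) (a : H →ₗ.[ℂ] H) {α : ℝ} (hα : 0 ≤ α) :
    Set (CommonForm a) :=
  ⋃ γ : Set.Ioi (0 : ℝ), restrictForm a hα γ.2.le '' (powerFormSpace M a α γ)

/-- The canonical mapping `φ_γ^α : S_{0,∞}^{α,γ} → 𝔖_0^α`, `x ↦ x`. -/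
def toLimit (M : VonNeumannAlgebra H) (a : H →ₗ.[ℂ] H) {α : ℝ} (hα : 0 ≤ α)
    (γ : Set.Ioi (0 : ℝ)) (s : powerFormSpace M a α γ) : limitSpace M a hα :=
  ⟨restrictForm a hα γ.2.le s, Set.mem_iUnion.2 ⟨γ, s, s.2, rfl⟩⟩

/-- `τ_0^α`, the strongest topology on `𝔖_0^α` for which all `φ_γ^α`, `γ > 0`, are continuous
with respect to the norm topologies on the spaces `S_{0,∞}^{α,γ}`. -/
abbrev limitTopology (M : VonNeumannAlgebra H) (a : H →ₗ.[ℂ] H) {α : ℝ} (hα : 0 ≤ α) :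
    TopologicalSpace (limitSpace M a hα) :=
  ⨆ γ : Set.Ioi (0 : ℝ), TopologicalSpace.coinduced (toLimit M a hα γ) (formTopology M _ _)

end PowerLimits

end

noncomputable section
namespace PowerLimits

variable {H : Type*} [NormedAddCommGroup H] [InnerProductSpace ℂ H] [CompleteSpace H]

/-! ### The shift inverse -/

/-! The point is that `a_0` is bounded: it is everywhere defined and equals some positive `A ∈ M`
(`exists_isBoundedBy_lowerPart`). Hence `a_0^s` is the everywhere defined operator `A ^ s`
(`IsBoundedBy.power`), and `A ^ β = A ^ (β - α) * A ^ α` with `T = A ^ (β - α)` in `M`. Since `T` is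
self-adjoint, `⟨x c f, T A^α g⟩ = ⟨T x c f, A^α g⟩` for `c = a_∞^γ`. The form represented by `x` at
exponent `β` is therefore represented by `T x ∈ M` at exponent `α`, with the same `γ`.

So each `S_{0,∞}^{β,γ}` embeds in `S_{0,∞}^{α,γ}` with norm at most `‖T‖`. Taking the union over `γ`
gives the inclusion of the limit spaces, and the universal property of the final topology gives its
continuity.

No spectral integral is used: boundedness of `a_0` comes from the resolvent `(1 + a)⁻¹`, and powers
come from norm convergence of the bounded approximations `b_μ`. -/

theorem IsShiftInverse.unique {b : H →ₗ.[ℂ] H} {μ : ℝ} {R R' : H →L[ℂ] H}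
    (hR : IsShiftInverse b μ R) (hR' : IsShiftInverse b μ R') : R = R' := by
  ext f
  obtain ⟨h, hf⟩ := hR'.1 f
  have := hR.2 ⟨R' f, h⟩
  rwa [hf] at this

theorem IsShiftInverse.shiftInverse_eq {b : H →ₗ.[ℂ] H} {μ : ℝ} {R : H →L[ℂ] H}
    (hR : IsShiftInverse b μ R) : shiftInverse b μ = R := by
  have h : ∃ R, IsShiftInverse b μ R := ⟨R, hR⟩
  rw [shiftInverse, dif_pos h]
  exact h.choose_spec.unique hR

theorem IsPositiveSelfAdjoint.inner_apply_left {b : H →ₗ.[ℂ] H} (hb : IsPositiveSelfAdjoint b)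
    (f g : b.domain) : inner ℂ (b f) (g : H) = inner ℂ (f : H) (b g) := by
  have h := LinearPMap.adjoint_isFormalAdjoint hb.isSelfAdjoint.dense_domain
  rw [LinearPMap.isSelfAdjoint_def.1 hb.isSelfAdjoint] at h
  exact h f g

theorem IsShiftInverse.isSelfAdjoint {b : H →ₗ.[ℂ] H} (hb : IsPositiveSelfAdjoint b) {μ : ℝ}
    {R : H →L[ℂ] H} (hR : IsShiftInverse b μ R) : IsSelfAdjoint R := by
  rw [ContinuousLinearMap.isSelfAdjoint_iff_isSymmetric]
  intro f g
  obtain ⟨hf, hf'⟩ := hR.1 f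
  obtain ⟨hg, hg'⟩ := hR.1 g
  have h := hb.inner_apply_left ⟨R f, hf⟩ ⟨R g, hg⟩
  change inner ℂ (R f) g = inner ℂ f (R g)
  conv_lhs => rw [← hg']
  conv_rhs => rw [← hf']
  rw [inner_add_left, inner_add_right, inner_smul_left, inner_smul_right, h]
  simp

/-- An operator of the commutant preserves `D(b)` and commutes with `b` there, hence commutes with
the resolvent; the bicommutant property concludes. -/
theorem IsShiftInverse.mem {M : VonNeumannAlgebra H} {b : H →ₗ.[ℂ] H} (hbM : IsAffiliated M b)
    {μ : ℝ} {R : H →L[ℂ] H} (hR : IsShiftInverse b μ R) : R ∈ M := by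
  rw [← VonNeumannAlgebra.commutant_commutant M, VonNeumannAlgebra.mem_commutant_iff]
  intro y hy
  ext f
  obtain ⟨hf, hf'⟩ := hR.1 f
  obtain ⟨h, hy'⟩ := hbM y hy ⟨R f, hf⟩
  have := hR.2 ⟨y (R f), h⟩
  rw [hy', ← map_smul, ← map_add, hf'] at this
  exact this.symm

/-! ### Operations that stay inside `M` -/

theorem mem_of_commute {M : VonNeumannAlgebra H} {x : H →L[ℂ] H}
    (h : ∀ y ∈ M.commutant, Commute x y) : x ∈ M := by
  rw [← VonNeumannAlgebra.commutant_commutant M, VonNeumannAlgebra.mem_commutant_iff]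
  exact fun y hy => (h y hy).symm

theorem commute_of_mem {M : VonNeumannAlgebra H} {x y : H →L[ℂ] H}
    (hx : x ∈ M) (hy : y ∈ M.commutant) : Commute x y :=
  VonNeumannAlgebra.mem_commutant_iff.1 hy x hx

theorem real_smul_one_mem (M : VonNeumannAlgebra H) (r : ℝ) : (r : ℂ) • (1 : H →L[ℂ] H) ∈ M :=
  M.toStarSubalgebra.smul_mem (one_mem M) _

theorem posPart_mem {M : VonNeumannAlgebra H} {x : H →L[ℂ] H} (hx : x ∈ M) : x⁺ ∈ M := by
  refine mem_of_commute fun y hy => ?_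
  rw [CFC.posPart_def]
  exact (commute_of_mem hx hy).cfcₙ_real _

theorem rpow_mem {M : VonNeumannAlgebra H} {x : H →L[ℂ] H} (hx : x ∈ M) (s : ℝ) : x ^ s ∈ M := by
  refine mem_of_commute fun y hy => ?_
  rw [CFC.rpow_def]
  exact (commute_of_mem hx hy).cfc_nnreal _

theorem inverse_mem {M : VonNeumannAlgebra H} {u : (H →L[ℂ] H)ˣ} (hu : (u : H →L[ℂ] H) ∈ M) :
    ((u⁻¹ : (H →L[ℂ] H)ˣ) : H →L[ℂ] H) ∈ M :=
  mem_of_commute fun _ hy => (commute_of_mem hu hy).units_inv_left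

/-- A projection lies in `M` once its range is invariant under the commutant, and kernels of
elements of `M` are. -/
theorem kerProj_mem {M : VonNeumannAlgebra H} {x : H →L[ℂ] H} (hx : x ∈ M) :
    (LinearMap.ker x.toLinearMap).starProjection ∈ M := by
  rw [VonNeumannAlgebra.IsStarProjection.mem_iff isStarProjection_starProjection]
  intro y hy
  rw [Submodule.range_starProjection]
  intro f hf
  have h : x (y f) = y (x f) := DFunLike.congr_fun (commute_of_mem hx hy) f
  have hf' : x f = 0 := hf
  change x (y f) = 0
  rw [h, hf', map_zero]

/-! ### The bounded part `a_0` -/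

/-- The partially defined operator `b` is everywhere defined and coincides with the bounded
operator `A`. -/
def IsBoundedBy (b : H →ₗ.[ℂ] H) (A : H →L[ℂ] H) : Prop :=
  ∀ f : H, ∃ h : f ∈ b.domain, b ⟨f, h⟩ = A f

/-- With `R = (1 + a)⁻¹` and `S = 1/2 - R`, the projection `p` onto `ker S⁺` is the spectral
projection for `[0, 1]`. On that kernel `R` agrees with the invertible operator `R + S⁺`, so `K = (R
+ S⁺)⁻¹` inverts `R` there. Thus `p f = R (K p f)` lies in `D(a)` and `a p = (K - 1) p`. -/
theorem exists_isBoundedBy_lowerPart (M : VonNeumannAlgebra H) (a : H →ₗ.[ℂ] H)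
    (ha : IsPositiveSelfAdjoint a) (haM : IsAffiliated M a) :
    ∃ A ∈ M, 0 ≤ A ∧ IsBoundedBy (lowerPart a) A := by
  obtain ⟨R, hR⟩ := ha.exists_isShiftInverse a 1 one_pos
  obtain rfl := hR.shiftInverse_eq
  set R := shiftInverse a 1
  have hRM := hR.mem haM
  have hRsa := hR.isSelfAdjoint ha
  set S : H →L[ℂ] H := (((1 + 1 : ℝ)⁻¹ : ℝ) : ℂ) • (1 : H →L[ℂ] H) - R with hS
  have hSsa : IsSelfAdjoint S := by
    refine IsSelfAdjoint.sub ?_ hRsa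
    have h : IsSelfAdjoint (((1 + 1 : ℝ)⁻¹ : ℝ) : ℂ) := Complex.conj_ofReal _
    exact h.smul (.one _)
  have hSM : S ∈ M := sub_mem (real_smul_one_mem M _) hRM
  have hSp := posPart_mem hSM
  set p := (LinearMap.ker (S⁺).toLinearMap).starProjection
  have hpS : spectralProj a 1 = p := rfl
  have hpM : p ∈ M := kerProj_mem hSp
  have hpp : IsStarProjection p := isStarProjection_starProjection
  have hkp : ∀ f, S⁺ (p f) = 0 := fun f =>
    Submodule.starProjection_apply_mem (LinearMap.ker (S⁺).toLinearMap) f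
  have hRS : Commute R S⁺ := by
    have h : Commute S R := by
      refine Commute.sub_left ?_ (Commute.refl R)
      exact (Commute.one_left R).smul_left _
    rw [CFC.posPart_def]
    exact (h.cfcₙ_real _).symm
  -- `S ≤ S⁺` says `1/2 ≤ R + S⁺`.
  have hunit : IsUnit (R + S⁺) := by
    refine CStarAlgebra.isUnit_of_le (a := (((1 + 1 : ℝ)⁻¹ : ℝ) : ℂ) • (1 : H →L[ℂ] H)) ?_ ?_
    · have := CFC.le_posPart (a := S)
      rw [hS, sub_le_iff_le_add', ← hS] at this
      exact this
    · have h : (((1 + 1 : ℝ)⁻¹ : ℝ) : ℂ) • (1 : H →L[ℂ] H) =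
          algebraMap ℝ (H →L[ℂ] H) (1 + 1)⁻¹ := by
        rw [Algebra.algebraMap_eq_smul_one]; rfl
      rw [h]
      exact (IsStrictlyPositive.iff_of_unital).2
        ⟨algebraMap_nonneg _ (by positivity), (Units.mk0 ((1 + 1 : ℝ)⁻¹) (by positivity)).isUnit.map _⟩
  obtain ⟨u, hu⟩ := hunit
  set K : H →L[ℂ] H := ((u⁻¹ : (H →L[ℂ] H)ˣ) : H →L[ℂ] H) with hK
  have hKM : K ∈ M := inverse_mem (by rw [hu]; exact add_mem hRM hSp)
  have huK : (R + S⁺) * K = 1 := by rw [← hu]; exact u.mul_inv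
  have hKS : Commute K S⁺ := by
    refine Commute.units_inv_left ?_
    rw [hu]
    exact hRS.add_left (.refl _)
  have hker : ∀ f, S⁺ f = 0 → R (K f) = f := by
    intro f hf
    have h1 : R (K f) + S⁺ (K f) = f := DFunLike.congr_fun huK f
    have h2 : K (S⁺ f) = S⁺ (K f) := DFunLike.congr_fun hKS f
    rwa [← h2, hf, map_zero, add_zero] at h1
  have hval : ∀ f, ∃ h : p f ∈ a.domain, a ⟨p f, h⟩ = K (p f) - p f := by
    intro f
    have h := hR.1 (K (p f))
    rw [hker _ (hkp f)] at h
    obtain ⟨h1, h2⟩ := h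
    refine ⟨h1, ?_⟩
    rw [eq_sub_iff_add_eq', ← h2]
    simp
  have hKsa : IsSelfAdjoint K := by
    have hu' : IsSelfAdjoint (u : H →L[ℂ] H) := by
      rw [hu]; exact hRsa.add (CFC.posPart_nonneg S).isSelfAdjoint
    have : star u = u := Units.ext hu'
    change star K = K
    rw [hK, ← Units.coe_star, star_inv, this]
  -- `K` commutes with `S⁺`, so it preserves `ker S⁺`. This makes `(K - 1) p` a compression by `p`,
  -- to which positivity of `a` transfers.
  have hinv : p * K * p = K * p := by
    ext f
    refine Submodule.starProjection_eq_self_iff.2 ?_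
    have h2 : K (S⁺ (p f)) = S⁺ (K (p f)) := DFunLike.congr_fun hKS (p f)
    change S⁺ (K (p f)) = 0
    rw [← h2, hkp, map_zero]
  refine ⟨(K - 1) * p, mul_mem (sub_mem hKM (one_mem M)) hpM, ?_, ?_⟩
  · have hA : (K - 1) * p = star p * (K - 1) * p := by
      rw [hpp.isSelfAdjoint.star_eq, mul_sub, sub_mul, sub_mul, hinv, mul_one,
        hpp.isIdempotentElem.eq, one_mul]
    rw [ContinuousLinearMap.nonneg_iff_isPositive, ContinuousLinearMap.isPositive_def']
    refine ⟨hA ▸ (hKsa.sub (.one _)).conjugate' p, fun f => ?_⟩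
    obtain ⟨h1, h2⟩ := hval f
    have h3 := ha.nonneg ⟨p f, h1⟩
    rw [h2] at h3
    rw [hA, hpp.isSelfAdjoint.star_eq, ContinuousLinearMap.reApplyInnerSelf_apply]
    have h4 : inner ℂ (p ((K - 1) (p f))) f = inner ℂ (K (p f) - p f) (p f) :=
      Submodule.inner_starProjection_left_eq_right _ _ _
    change 0 ≤ RCLike.re (inner ℂ (p ((K - 1) (p f))) f)
    rw [h4]
    exact h3
  · intro f
    obtain ⟨h1, h2⟩ := hval f
    refine ⟨?_, ?_⟩
    · exact h1
    · exact h2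

/-! ### Powers of bounded operators -/

theorem spectrum_subset_Icc {A : H →L[ℂ] H} (hA : 0 ≤ A) {t : ℝ} (ht : t ∈ spectrum ℝ A) :
    0 ≤ t ∧ t ≤ ‖A‖ := by
  refine ⟨spectrum_nonneg_of_nonneg hA ht, ?_⟩
  have h := spectrum.subset_closedBall_norm_mul A ht
  rw [mem_closedBall_zero_iff] at h
  exact (le_abs_self t).trans (h.trans
    (mul_le_of_le_one_right (norm_nonneg _) ContinuousLinearMap.norm_id_le))

/-- For bounded `b` the resolvent is itself a continuous function of `A`, so limits in `μ` reduce to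
scalar estimates on the spectrum. -/
theorem IsBoundedBy.approx_eq {b : H →ₗ.[ℂ] H} {A : H →L[ℂ] H} (hbA : IsBoundedBy b A)
    (hA : 0 ≤ A) {μ : ℝ} (hμ : 0 < μ) :
    approx b μ = cfc (fun t : ℝ => μ * (1 - μ * (μ + t)⁻¹)) A := by
  have hne : ∀ t ∈ spectrum ℝ A, μ + t ≠ 0 := fun t ht =>
    (add_pos_of_pos_of_nonneg hμ (spectrum_subset_Icc hA ht).1).ne'
  have hsa : IsSelfAdjoint A := hA.isSelfAdjoint
  have hadd : ContinuousOn (fun t : ℝ => μ + t) (spectrum ℝ A) :=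
    (continuous_const.add continuous_id).continuousOn
  have hcont : ContinuousOn (fun t : ℝ => (μ + t)⁻¹) (spectrum ℝ A) :=
    (continuousOn_const.add continuousOn_id).inv₀ hne
  set Q := cfc (fun t : ℝ => (μ + t)⁻¹) A with hQ
  have hμA : cfc (fun t : ℝ => μ + t) A = (μ : ℂ) • (1 : H →L[ℂ] H) + A := by
    rw [cfc_const_add μ (fun t => t) A continuousOn_id hsa, cfc_id' ℝ A hsa, Algebra.algebraMap_eq_smul_one]
    rfl
  have h1 : ((μ : ℂ) • (1 : H →L[ℂ] H) + A) * Q = 1 := by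
    rw [← hμA, hQ, ← cfc_mul _ _ A hadd hcont, ← cfc_const_one ℝ A hsa]
    exact cfc_congr fun t ht => mul_inv_cancel₀ (hne t ht)
  have h2 : Q * ((μ : ℂ) • (1 : H →L[ℂ] H) + A) = 1 := by
    rw [← hμA, hQ, ← cfc_mul _ _ A hcont hadd, ← cfc_const_one ℝ A hsa]
    exact cfc_congr fun t ht => inv_mul_cancel₀ (hne t ht)
  have hs : IsShiftInverse b μ Q := by
    refine ⟨fun f => ?_, fun f => ?_⟩
    · obtain ⟨h, h'⟩ := hbA (Q f)
      refine ⟨h, ?_⟩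
      rw [h']
      exact DFunLike.congr_fun h1 f
    · obtain ⟨h, h'⟩ := hbA f
      rw [h']
      exact DFunLike.congr_fun h2 (f : H)
  have hmul : ContinuousOn (fun t : ℝ => μ * (μ + t)⁻¹) (spectrum ℝ A) :=
    continuousOn_const.mul hcont
  rw [approx, hs.shiftInverse_eq, cfc_const_mul μ (fun t => 1 - μ * (μ + t)⁻¹) A (continuousOn_const.sub hmul),
    cfc_sub (fun _ => 1) (fun t => μ * (μ + t)⁻¹) A continuousOn_const hmul, cfc_const_one ℝ A hsa, cfc_const_mul μ _ A hcont, ← hQ]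
  rfl

theorem IsBoundedBy.tendsto_approx {b : H →ₗ.[ℂ] H} {A : H →L[ℂ] H} (hbA : IsBoundedBy b A)
    (hA : 0 ≤ A) : Tendsto (approx b) atTop (𝓝 A) := by
  rw [tendsto_iff_norm_sub_tendsto_zero]
  refine squeeze_zero' (Eventually.of_forall fun _ => norm_nonneg _) ?_
    (tendsto_const_nhds.div_atTop tendsto_id : Tendsto (fun μ : ℝ => ‖A‖ ^ 2 / μ) atTop (𝓝 0))
  filter_upwards [eventually_gt_atTop 0] with μ hμ
  have hne : ∀ t ∈ spectrum ℝ A, μ + t ≠ 0 := fun t ht =>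
    (add_pos_of_pos_of_nonneg hμ (spectrum_subset_Icc hA ht).1).ne'
  have hcont : ContinuousOn (fun t : ℝ => (μ + t)⁻¹) (spectrum ℝ A) :=
    (continuousOn_const.add continuousOn_id).inv₀ hne
  have h : approx b μ - A = cfc (fun t : ℝ => μ * (1 - μ * (μ + t)⁻¹) - t) A := by
    rw [cfc_sub (fun t : ℝ => μ * (1 - μ * (μ + t)⁻¹)) (fun t => t) A
      (continuousOn_const.mul (continuousOn_const.sub (continuousOn_const.mul hcont)))
      continuousOn_id, cfc_id' ℝ A hA.isSelfAdjoint, hbA.approx_eq hA hμ]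
  rw [h]
  refine norm_cfc_le (by positivity) fun t ht => ?_
  obtain ⟨h0, h1⟩ := spectrum_subset_Icc hA ht
  -- The scalar error is `t² / (μ + t) ≤ ‖A‖² / μ`, uniformly on the spectrum.
  have h2 : μ * (1 - μ * (μ + t)⁻¹) - t = -(t ^ 2 / (μ + t)) := by
    field_simp [hne t ht]; ring
  rw [h2, norm_neg, Real.norm_of_nonneg (by positivity)]
  gcongr
  linarith

theorem IsBoundedBy.approx_nonneg {b : H →ₗ.[ℂ] H} {A : H →L[ℂ] H} (hbA : IsBoundedBy b A)
    (hA : 0 ≤ A) {μ : ℝ} (hμ : 0 < μ) : 0 ≤ approx b μ := by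
  rw [hbA.approx_eq hA hμ]
  refine cfc_nonneg fun t ht => mul_nonneg hμ.le (sub_nonneg.2 ?_)
  have := (spectrum_subset_Icc hA ht).1
  rw [← div_eq_mul_inv]
  exact div_le_one_of_le₀ (by linarith) (by linarith)

theorem spectrum_nnreal_subset_Icc {B : H →L[ℂ] H} (hB : 0 ≤ B) {C : NNReal} (hC : ‖B‖ ≤ C) :
    spectrum NNReal B ⊆ Set.Icc 0 C := fun _ hr =>
  ⟨zero_le, NNReal.coe_le_coe.1
    ((spectrum_subset_Icc hB (spectrum.algebraMap_mem ℝ hr)).2.trans hC)⟩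

theorem IsBoundedBy.tendsto_approx_rpow {b : H →ₗ.[ℂ] H} {A : H →L[ℂ] H}
    (hbA : IsBoundedBy b A) (hA : 0 ≤ A) {s : ℝ} (hs : 0 ≤ s) :
    Tendsto (fun μ => approx b μ ^ s) atTop (𝓝 (A ^ s)) := by
  have ht := hbA.tendsto_approx hA
  -- The functional calculus is continuous in the operator as long as the spectra stay in one
  -- compact set; `‖A‖ + 1` leaves room for the approximants.
  refine Filter.Tendsto.cfc_nnreal (s := Set.Icc 0 (‖A‖₊ + 1)) isCompact_Icc (fun x => x ^ s) ht
    ?_ ?_ ?_ hA (NNReal.continuous_rpow_const hs).continuousOn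
  · filter_upwards [eventually_gt_atTop 0,
      ht.norm.eventually (eventually_le_nhds (lt_add_one ‖A‖))] with μ hμ hμ'
    exact spectrum_nnreal_subset_Icc (hbA.approx_nonneg hA hμ) (by simpa using hμ')
  · filter_upwards [eventually_gt_atTop 0] with μ hμ using hbA.approx_nonneg hA hμ
  · exact spectrum_nnreal_subset_Icc hA (by simp)

theorem IsBoundedBy.power {b : H →ₗ.[ℂ] H} {A : H →L[ℂ] H}
    (hbA : IsBoundedBy b A) (hA : 0 ≤ A) {s : ℝ} (hs : 0 ≤ s) :
    IsBoundedBy (power b s) (A ^ s) := by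
  intro f
  have ht : Tendsto (fun μ => (approx b μ ^ s : H →L[ℂ] H) f) atTop (𝓝 ((A ^ s : H →L[ℂ] H) f)) :=
    ((ContinuousLinearMap.apply ℂ H f).continuous.tendsto _).comp (hbA.tendsto_approx_rpow hA hs)
  have hf : f ∈ (PowerLimits.power b s).domain := ⟨_, ht⟩
  exact ⟨hf, tendsto_nhds_unique hf.choose_spec ht⟩

theorem rpow_eq_mul_rpow (A : H →L[ℂ] H) {s t : ℝ} (hs : 0 ≤ s) (hst : s < t) :
    A ^ t = A ^ (t - s) * A ^ s := by
  rw [CFC.rpow_def, CFC.rpow_def, CFC.rpow_def, ← cfc_mul _ _ A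
    (NNReal.continuous_rpow_const (sub_pos.2 hst).le).continuousOn
    (NNReal.continuous_rpow_const hs).continuousOn]
  refine cfc_congr fun x _ => ?_
  change x ^ t = x ^ (t - s) * x ^ s
  -- Only the total exponent `t` must be nonzero, so `x = 0` and `s = 0` are covered, with `0 ^ 0 =
  -- 1`.
  rw [← NNReal.rpow_add' (by linarith), sub_add_cancel]

/-! ### The inclusion of the normed spaces -/

/-- Restriction of a form on `D(d) × D(c)` to `D(d) × D(b)`, where `D(b) ⊆ D(c)`. -/
def restrictRight {b c : H →ₗ.[ℂ] H} {d : H →ₗ.[ℂ] H} (h : b.domain ≤ c.domain) (s : Form c d) :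
    Form b d :=
  LinearMap.mk₂'ₛₗ (RingHom.id ℂ) (starRingEnd ℂ)
    (fun f g => s f (Submodule.inclusion h g))
    (by intros; simp) (by intros; simp) (by intros; simp) (by intros; simp)

theorem restrictRight_formOf {b c d : H →ₗ.[ℂ] H} (h : b.domain ≤ c.domain) {T : H →L[ℂ] H}
    (hT : ∀ g : b.domain, c (Submodule.inclusion h g) = T (b g)) (x : H →L[ℂ] H) :
    restrictRight h (formOf c d x) = formOf b d (star T * x) := by
  ext f g
  change inner ℂ (c (Submodule.inclusion h g)) (x (d f)) = inner ℂ (b g) ((star T) (x (d f)))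
  rw [hT, ContinuousLinearMap.star_eq_adjoint, ContinuousLinearMap.adjoint_inner_right]

/-- If `c = T b` on `D(b) ⊆ D(c)` with `T ∈ M`, restriction maps `S_{c,d}(M)` to `S_{b,d}(M)`. -/
def formSpaceMap (M : VonNeumannAlgebra H) {b c : H →ₗ.[ℂ] H} (d : H →ₗ.[ℂ] H)
    (h : b.domain ≤ c.domain) {T : H →L[ℂ] H} (hTM : T ∈ M)
    (hT : ∀ g : b.domain, c (Submodule.inclusion h g) = T (b g)) :
    formSpace M c d →+ formSpace M b d where
  toFun s := ⟨restrictRight h s, by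
    obtain ⟨x, hx, hs⟩ := s.2
    exact ⟨star T * x, (mul_mem (star_mem hTM) hx : star T * x ∈ M), by rw [← hs, restrictRight_formOf h hT]⟩⟩
  map_zero' := rfl
  map_add' _ _ := rfl

/-- Every representative `x` of `s` gives the representative `star T * x` of its image, of norm at
most `‖T‖ * ‖x‖`; then take the infimum over `x`. -/
theorem formNorm_formSpaceMap_le (M : VonNeumannAlgebra H) {b c : H →ₗ.[ℂ] H} (d : H →ₗ.[ℂ] H)
    (h : b.domain ≤ c.domain) {T : H →L[ℂ] H} (hTM : T ∈ M)
    (hT : ∀ g : b.domain, c (Submodule.inclusion h g) = T (b g)) (s : formSpace M c d) :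
    formNorm M b d (formSpaceMap M d h hTM hT s) ≤ ‖T‖ * formNorm M c d s := by
  change sInf _ ≤ ‖T‖ * sInf _
  rw [← smul_eq_mul, ← Real.sInf_smul_of_nonneg (norm_nonneg T)]
  refine le_csInf (reprNorms_nonempty M c d s).smul_set ?_
  rintro _ ⟨_, ⟨x, hx, hs, rfl⟩, rfl⟩
  refine (csInf_le (reprNorms_bddBelow M b d _)
    ⟨star T * x, mul_mem (star_mem hTM) hx, ?_, rfl⟩).trans ?_
  · rw [← restrictRight_formOf h hT, hs]; rfl
  · exact (norm_mul_le _ _).trans_eq (by rw [norm_star]; rfl)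

theorem continuous_formSpaceMap (M : VonNeumannAlgebra H) {b c : H →ₗ.[ℂ] H} (d : H →ₗ.[ℂ] H)
    (h : b.domain ≤ c.domain) {T : H →L[ℂ] H} (hTM : T ∈ M)
    (hT : ∀ g : b.domain, c (Submodule.inclusion h g) = T (b g)) :
    Continuous[formTopology M c d, formTopology M b d] (formSpaceMap M d h hTM hT) := by
  let := (formNorm M c d).toNormedAddCommGroup
  let := (formNorm M b d).toNormedAddCommGroup
  exact AddMonoidHomClass.continuous_of_bound (formSpaceMap M d h hTM hT) ‖T‖
    (formNorm_formSpaceMap_le M d h hTM hT)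

end PowerLimits

end

/-! ### Passage to the limit spaces -/

open PowerLimits in
theorem mainTheorem8 {H : Type*} [NormedAddCommGroup H] [InnerProductSpace ℂ H] [CompleteSpace H]
    (M : VonNeumannAlgebra H) (a : H →ₗ.[ℂ] H)
    (ha : IsPositiveSelfAdjoint a) (haM : IsAffiliated M a)
    (α β : ℝ) (hα : 0 ≤ α) (hαβ : α < β) :
    ∃ hsub : limitSpace M a (hα.trans hαβ.le) ⊆ limitSpace M a hα,
      (∀ X : Set (limitSpace M a hα), IsOpen[limitTopology M a hα] X →
        IsOpen[limitTopology M a (hα.trans hαβ.le)] (Set.inclusion hsub ⁻¹' X)) ∧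
      Continuous[limitTopology M a (hα.trans hαβ.le), limitTopology M a hα]
        (Set.inclusion hsub) := by
  have hβ : 0 ≤ β := hα.trans hαβ.le
  obtain ⟨A, hAM, hA, hbA⟩ := exists_isBoundedBy_lowerPart M a ha haM
  -- Both domains are all of `H`, so the inclusion holds in this direction too.
  have hle : (power (lowerPart a) α).domain ≤ (power (lowerPart a) β).domain :=
    fun f _ => (hbA.power hA hβ f).1
  have hT : ∀ g, power (lowerPart a) β (Submodule.inclusion hle g) =
      (A ^ (β - α) : H →L[ℂ] H) (power (lowerPart a) α g) := by
    intro g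
    refine (hbA.power hA hβ g).2.trans ?_
    rw [rpow_eq_mul_rpow A hα hαβ]
    exact congrArg (A ^ (β - α) : H →L[ℂ] H) (hbA.power hA hα g).2.symm
  have hTM := rpow_mem hAM (β - α)
  have hsub : limitSpace M a hβ ⊆ limitSpace M a hα := by
    intro s hs
    obtain ⟨γ, s, hsγ, rfl⟩ := Set.mem_iUnion.1 hs
    -- The intermediate restriction disappears on the common domain: both forms are the same element
    -- of `CommonForm a`.
    exact (toLimit M a hα γ (formSpaceMap M _ hle hTM hT ⟨s, hsγ⟩)).2
  have hcont : Continuous[limitTopology M a hβ, limitTopology M a hα] (Set.inclusion hsub) := by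
    -- By the universal property it suffices to check each composite with `φ_γ^β`, which factors
    -- through `S_{0,∞}^{α,γ}` and `φ_γ^α`.
    refine continuous_iSup_dom.2 fun γ => continuous_coinduced_dom.2 ?_
    let := formTopology M (power (lowerPart a) β) (power (upperPart a) γ)
    let := formTopology M (power (lowerPart a) α) (power (upperPart a) γ)
    let := limitTopology M a hα
    have h : Continuous (toLimit M a hα γ) :=
      continuous_iSup_rng (i := γ) continuous_coinduced_rng
    exact h.comp (continuous_formSpaceMap M (power (upperPart a) γ) hle hTM hT)
  exact ⟨hsub, fun X hX => continuous_def.1 hcont X hX, hcont⟩
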